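/- Proposition 9.6 (P-limit rank). Let $K$ be a field and let $R$ be a unital $K$-algebra with a Sylvester matrix rank function $\mathrm{rk}$, i.e. a function from the rectangular matrices over $R$ to $\mathbb R_{\ge 0}$ with $\mathrm{rk}(0)=0$, $\mathrm{rk}(1_R)=1$, $\mathrm{rk}(AB)\le\min(\mathrm{rk}(A),\mathrm{rk}(B))$, $\mathrm{rk}\begin{pmatrix}A&0\\0&B\end{pmatrix}=\mathrm{rk}(A)+\mathrm{rk}(B)$ and $\mathrm{rk}\begin{pmatrix}A&C\\0&B\end{pmatrix}\ge\mathrm{rk}(A)+\mathrm{rk}(B)$. (Then $R$ has invariant basis number.) Let $S=K(t)\otimes_K R$, a ring containing $R$ and $R[t]=K[t]\otimes_K R$, regarded as a left $R$-module, let $\mathcal F$ be the collection of the left $R$-submodules $V\otimes_K R$ of $S$ for $V$ ranging over the finite-dimensional $K$-linear subspaces of $K(t)$, and let $\hat{\mathcal F}$ be the set of nonzero members of $\mathcal F$. Write $\dim(\mathcal W)$ for the rank of $\mathcal W\in\mathcal F$ as a free left $R$-module. For $A\in M_{n,m}(S)$ and $\mathcal W\in\hat{\mathcal F}$, choose $\mathcal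 W'\in\hat{\mathcal F}$ with $\mathcal W A_{i,j}\subseteq \mathcal W'$ for all $i,j$, and let $\mathrm{rk}_{\mathcal W}(A)=\mathrm{rk}(B)$, where $B$ is the matrix over $R$ of the map $\mathcal W^n\to(\mathcal W')^m$, $w\mapsto wA$ (on row vectors), in some $R$-bases; this does not depend on the choices. For a finite set $V\subseteq S$ and $\varepsilon>0$, $\mathcal W\in\hat{\mathcal F}$ is called $(V,\varepsilon)$-invariant if some $\mathcal W'\in\mathcal F$ contains $\mathcal W+\mathcal W V$ and satisfies $\dim(\mathcal W')\le(1+\varepsilon)\dim(\mathcal W)$. An ultrafilter $\omega$ on $\hat{\mathcal F}$ is called non-principal if for every finite $V\subseteq S$ and every $\varepsilon>0$ it contains the set of all $(V,\varepsilon)$-invariant $\mathcal W\in\hat{\mathcal F}$; such ultrafilters exist. Given one, put $$\mathrm{rk}_{\mathcal F}(A)=\lim_{\mathcal W\to\omega}\frac{\mathrm{rk}_{\mathcal W}(A)}{\dim(\mathcal W)},$$ a limit that exists. Let $(x_i)_{i\in\mathbb N}$ be a sequence of distinct elements of $K$, and let $\pi_i:R[t]\to R$ be the evaluation $f(t)\mapsto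 f(x_i)$, applied entrywise to matrices. Then for every non-principal ultrafilter $\omega$ on $\hat{\mathcal F}$, all $n,m$ and every $A\in M_{n,m}(R[t])$, the sequence $\mathrm{rk}(\pi_i(A))$ converges and $$\mathrm{rk}_{\mathcal F}(A)=\lim_{i\to\infty}\mathrm{rk}(\pi_i(A)).$$ -/

import Mathlib

open Filter Topology
open scoped TensorProduct

/-- A Sylvester matrix rank function for a unital ring `R`: a nonnegative real-valued function on
the rectangular matrices over `R` (of all sizes) satisfying the four axioms of Malcolmson. -/
structure SylvesterRank (R : Type*) [Ring R] where
  /-- the rank of a matrix -/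
  rk : ∀ {n m : ℕ}, Matrix (Fin n) (Fin m) R → ℝ
  rk_nonneg : ∀ {n m : ℕ} (A : Matrix (Fin n) (Fin m) R), 0 ≤ rk A
  rk_zero : ∀ n m : ℕ, rk (0 : Matrix (Fin n) (Fin m) R) = 0
  rk_one : rk (1 : Matrix (Fin 1) (Fin 1) R) = 1
  rk_mul_le : ∀ {n m k : ℕ} (A : Matrix (Fin n) (Fin m) R) (B : Matrix (Fin m) (Fin k) R),
    rk (A * B) ≤ min (rk A) (rk B)
  rk_diag : ∀ {n m k l : ℕ} (A : Matrix (Fin n) (Fin m) R) (B : Matrix (Fin k) (Fin l) R),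
    rk (Matrix.reindex finSumFinEquiv finSumFinEquiv (Matrix.fromBlocks A 0 0 B)) = rk A + rk B
  rk_triangular : ∀ {n m k l : ℕ} (A : Matrix (Fin n) (Fin m) R) (B : Matrix (Fin k) (Fin l) R)
    (C : Matrix (Fin n) (Fin l) R),
    rk A + rk B ≤ rk (Matrix.reindex finSumFinEquiv finSumFinEquiv (Matrix.fromBlocks A C 0 B))

namespace AmenableExtension

section General

/-- For a finitely generated free left module `M` over a ring `R` with invariant basis number, the
integer `d` with `M ≅ R ^ d`. (`Module.finrank` is not this number for a general noncommutative
ring with invariant basis number: over a free algebra of rank two, `R` itself contains infinite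
linearly independent families.) -/
noncomputable def freeDim (R M : Type*) [Ring R] [AddCommGroup M] [Module R M] : ℕ :=
  sInf {d : ℕ | Nonempty (M ≃ₗ[R] (Fin d → R))}

variable {R S : Type*} [Ring R] [Ring S] [Module R S]

/-- The nonzero members of a collection `F` of left `R`-submodules of `S`. -/
abbrev Hat (F : Set (Submodule R S)) : Type _ := {W : Submodule R S // W ∈ F ∧ W ≠ ⊥}

/-- The nonzero member `W` of `F` is `(V, ε)`-invariant: some member of `F` of rank at most
`(1 + ε) dim W` contains `W + W V`. -/
def IsInvariant (F : Set (Submodule R S)) (V : Finset S) (ε : ℝ) (W : Hat F) : Prop :=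
  ∃ W' ∈ F, W.1 ≤ W' ∧ (∀ w ∈ W.1, ∀ v ∈ V, w * v ∈ W') ∧
    (freeDim R W' : ℝ) ≤ (1 + ε) * freeDim R W.1

/-- An ultrafilter on the set of nonzero members of `F` is non-principal if for every finite
`V ⊆ S` and `ε > 0` it contains the set of all `(V, ε)`-invariant members. -/
def IsNonprincipal {F : Set (Submodule R S)} (ω : Ultrafilter (Hat F)) : Prop :=
  ∀ (V : Finset S) (ε : ℝ), 0 < ε → {W : Hat F | IsInvariant F V ε W} ∈ ω

/-- The real number `r` is `rk B` for a matrix `B` over `R` that represents `w ↦ w A`, as a map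
from `W ^ n` (row vectors) to `W' ^ m`, in some bases of these left `R`-modules, where `W'` is a
nonzero member of `F` with `W A i j ⊆ W'` for all `i` and `j`. -/
def IsLocalRank (ρ : SylvesterRank R) (F : Set (Submodule R S)) (W : Hat F) {n m : ℕ}
    (A : Matrix (Fin n) (Fin m) S) (r : ℝ) : Prop :=
  ∃ W' : Hat F, (∀ i j, ∀ w ∈ W.1, w * A i j ∈ W'.1) ∧
    ∃ (l p : ℕ) (b : Module.Basis (Fin l) R (Fin n → W.1))
      (b' : Module.Basis (Fin p) R (Fin m → W'.1)) (B : Matrix (Fin l) (Fin p) R),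
      (∀ a : Fin l, Matrix.vecMul (fun i => (b a i : S)) A =
        ∑ c : Fin p, B a c • (fun j => (b' c j : S))) ∧ r = ρ.rk B

/-- `rk_W(A)`: the rank of a matrix over `R` representing right multiplication by `A` on `W ^ n`.
For a finite approximation system `F` such a matrix exists and its rank does not depend on the
choices, so that an arbitrary choice is made here. -/
noncomputable def localRank (ρ : SylvesterRank R) (F : Set (Submodule R S)) (W : Hat F) {n m : ℕ}
    (A : Matrix (Fin n) (Fin m) S) : ℝ :=
  Classical.epsilon (IsLocalRank ρ F W A)

/-- The normalized rank `rk_W(A) / dim W`. -/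
noncomputable def normalizedRank (ρ : SylvesterRank R) (F : Set (Submodule R S)) {n m : ℕ}
    (A : Matrix (Fin n) (Fin m) S) (W : Hat F) : ℝ :=
  localRank ρ F W A / freeDim R W.1

/-- `rk_F(A)`: the limit of `rk_W(A) / dim W` along the ultrafilter `ω`. -/
noncomputable def extendedRank (ρ : SylvesterRank R) (F : Set (Submodule R S))
    (ω : Ultrafilter (Hat F)) {n m : ℕ} (A : Matrix (Fin n) (Fin m) S) : ℝ :=
  limUnder (ω : Filter (Hat F)) (normalizedRank ρ F A)

end General

section FieldExtension

variable (K E R : Type*) [Field K] [Field E] [Algebra K E] [Ring R] [Algebra K R]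

/-- The collection of the left `R`-submodules `R ⊗ V` (the `R`-span of the `1 ⊗ v` with `v ∈ V`)
of `R ⊗ E`, for `V` ranging over the finite-dimensional `K`-subspaces of `E`. The ring `E ⊗ R` is
written with its two factors exchanged, so that its left `R`-module structure is that of the first
tensor factor. -/
def fieldSystem : Set (Submodule R (R ⊗[K] E)) :=
  {W | ∃ V : Submodule K E, FiniteDimensional K V ∧ W = V.baseChange R}

/-- The canonical ring homomorphism `R[t] → R ⊗ K(t)` sending `a` in `R` to `a ⊗ 1` and `t` to
`1 ⊗ t`. -/
noncomputable def polynomialInclusion : Polynomial R →+* R ⊗[K] RatFunc K :=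
  Polynomial.eval₂RingHom'
    (Algebra.TensorProduct.includeLeftRingHom : R →+* R ⊗[K] RatFunc K)
    (1 ⊗ₜ[K] RatFunc.X)
    (fun a => by simp [Commute, SemiconjBy, Algebra.TensorProduct.tmul_mul_tmul])

/-- Evaluation `R[t] → R` at the (central) element `x` of `K`. -/
noncomputable def evalAt (x : K) : Polynomial R →+* R :=
  Polynomial.eval₂RingHom' (RingHom.id R) (algebraMap K R x)
    (fun a => (Algebra.commutes x a).symm)

end FieldExtension

end AmenableExtension

/-!
Let `a i = rk (π_i A)` and let `W = R ⊗ V` with `dim V = N`. Fix an infinite set `T` of indices and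
a common denominator `q` of the elements of `V`. The functionals `v ↦ (q v)(x i)` with `i ∈ T`
separate the points of `V`, since a nonzero polynomial has finitely many roots, so that `N` of them
give an isomorphism `V ≅ K ^ N`. After tensoring with `R` they commute with right multiplication by
`A`, if `A` is replaced by its value at `x i`: on `W ^ n`, evaluation turns `w ↦ w A` into the
direct sum of the maps `π_i A` for the chosen `N` indices `i`. If `W' = R ⊗ V'` contains `W` and all
`W A i j`, the evaluation map `W' ^ m → R ^ (N m)` is a split surjection, and the projection onto its
kernel has rank at most `m (dim V' - N)`. Therefore
`∑ a i ≤ rk_W(A) ≤ ∑ a i + m (dim V' - N)`, the sums being over the `N` chosen indices in `T`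
(`exists_points_linRank_rightMul_bounds`).

For `W` sufficiently invariant the error is at most `m ε N`. Hence every bound for the `a i` that
holds on *some infinite set* `T` passes to `rk_W(A) / dim W` up to `m ε`. The normalized ranks are
bounded, so that they converge to some `L` along the ultrafilter; and then for every `δ > 0` at most
finitely many `a i` can be `≥ L + δ` or `≤ L - δ` (`exists_tendsto_normalizedRank_and_rk`).

Non-principal ultrafilters exist because the polynomials of degree less than `N` span invariant
members of the system, for `N` large (`exists_isInvariant`).
-/

/-! ### Ranks of linear maps between finite free modules -/

namespace SylvesterRank

variable {R : Type*} [Ring R] (ρ : SylvesterRank R)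

lemma rk_submatrix_le {n m n' m' : ℕ} (A : Matrix (Fin n) (Fin m) R) (e : Fin n' → Fin n)
    (f : Fin m' → Fin m) : ρ.rk (A.submatrix e f) ≤ ρ.rk A := by
  have h : A.submatrix e f = (1 : Matrix (Fin n) (Fin n) R).submatrix e id *
      (A * (1 : Matrix (Fin m) (Fin m) R).submatrix id f) := by
    ext i j
    simp [Matrix.mul_apply, Matrix.one_apply]
  rw [h]
  exact (ρ.rk_mul_le _ _).trans ((min_le_right _ _).trans
    ((ρ.rk_mul_le _ _).trans (min_le_left _ _)))

lemma rk_one_fin (n : ℕ) : ρ.rk (1 : Matrix (Fin n) (Fin n) R) = n := by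
  induction n with
  | zero => rw [Subsingleton.elim (1 : Matrix (Fin 0) (Fin 0) R) 0, ρ.rk_zero]; simp
  | succ n ih =>
    have h := ρ.rk_diag (1 : Matrix (Fin n) (Fin n) R) (1 : Matrix (Fin 1) (Fin 1) R)
    rw [Matrix.fromBlocks_one, ih, ρ.rk_one, Matrix.reindex_apply,
      Matrix.submatrix_one_equiv] at h
    rw [h]; push_cast; rfl

lemma rk_le_rows {n m : ℕ} (A : Matrix (Fin n) (Fin m) R) : ρ.rk A ≤ n := by
  have h := (ρ.rk_mul_le (1 : Matrix (Fin n) (Fin n) R) A).trans (min_le_left _ _)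
  rwa [Matrix.one_mul, ρ.rk_one_fin] at h

/-- The rank of a matrix with arbitrary finite index types, computed after an arbitrary numbering
of its rows and columns. -/
noncomputable def matrixRank {α β : Type*} [Fintype α] [Fintype β] (A : Matrix α β R) : ℝ :=
  ρ.rk (A.submatrix (Fintype.equivFin α).symm (Fintype.equivFin β).symm)

section Matrix

variable {α β γ δ : Type*} [Fintype α] [Fintype β] [Fintype γ] [Fintype δ]

lemma matrixRank_submatrix_le (A : Matrix α β R) (e : γ → α) (f : δ → β) :
    ρ.matrixRank (A.submatrix e f) ≤ ρ.matrixRank A := by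
  have h := ρ.rk_submatrix_le
    (A.submatrix (Fintype.equivFin α).symm (Fintype.equivFin β).symm)
    (Fintype.equivFin α ∘ e ∘ (Fintype.equivFin γ).symm)
    (Fintype.equivFin β ∘ f ∘ (Fintype.equivFin δ).symm)
  unfold matrixRank
  convert h using 2
  ext i j
  simp

lemma matrixRank_submatrix_equiv (A : Matrix α β R) (e : γ ≃ α) (f : δ ≃ β) :
    ρ.matrixRank (A.submatrix e f) = ρ.matrixRank A := by
  refine le_antisymm (ρ.matrixRank_submatrix_le A e f) ?_
  have h := ρ.matrixRank_submatrix_le (A.submatrix e f) e.symm f.symm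
  simpa using h

lemma matrixRank_fin {n m : ℕ} (A : Matrix (Fin n) (Fin m) R) : ρ.matrixRank A = ρ.rk A := by
  refine le_antisymm (ρ.rk_submatrix_le A _ _) ?_
  simpa [matrixRank] using ρ.rk_submatrix_le
    (A.submatrix (Fintype.equivFin (Fin n)).symm (Fintype.equivFin (Fin m)).symm)
    (Fintype.equivFin (Fin n)) (Fintype.equivFin (Fin m))

lemma matrixRank_mul_le (A : Matrix α β R) (B : Matrix β γ R) :
    ρ.matrixRank (A * B) ≤ min (ρ.matrixRank A) (ρ.matrixRank B) := by
  have h := ρ.rk_mul_le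
    (A.submatrix (Fintype.equivFin α).symm (Fintype.equivFin β).symm)
    (B.submatrix (Fintype.equivFin β).symm (Fintype.equivFin γ).symm)
  rwa [Matrix.submatrix_mul_equiv] at h

lemma matrixRank_fromBlocks (A : Matrix α β R) (B : Matrix γ δ R) :
    ρ.matrixRank (Matrix.fromBlocks A 0 0 B) = ρ.matrixRank A + ρ.matrixRank B := by
  have h := ρ.rk_diag
    (A.submatrix (Fintype.equivFin α).symm (Fintype.equivFin β).symm)
    (B.submatrix (Fintype.equivFin γ).symm (Fintype.equivFin δ).symm)
  rw [← ρ.matrixRank_fin, Matrix.reindex_apply, ρ.matrixRank_submatrix_equiv] at h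
  unfold matrixRank at h ⊢
  rw [← h]
  change ρ.matrixRank (Matrix.fromBlocks A 0 0 B) = ρ.matrixRank (Matrix.fromBlocks _ _ _ _)
  rw [← ρ.matrixRank_submatrix_equiv (Matrix.fromBlocks A 0 0 B)
    (Equiv.sumCongr (Fintype.equivFin α).symm (Fintype.equivFin γ).symm)
    (Equiv.sumCongr (Fintype.equivFin β).symm (Fintype.equivFin δ).symm)]
  congr 1
  ext (i | i) (j | j) <;> simp

lemma matrixRank_one [DecidableEq α] :
    ρ.matrixRank (1 : Matrix α α R) = Fintype.card α := by
  unfold matrixRank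
  rw [Matrix.submatrix_one_equiv, ρ.rk_one_fin]

end Matrix

section LinearMap

variable {M M' M'' N N' : Type*} [AddCommGroup M] [Module R M] [AddCommGroup M'] [Module R M']
  [AddCommGroup M''] [Module R M''] [AddCommGroup N] [Module R N] [AddCommGroup N'] [Module R N']

/-- The matrix of a linear map of left modules, acting on row vectors: row `i` holds the
coordinates of the image of the `i`-th basis vector. -/
noncomputable def rowMatrix {α β : Type*} (b : Module.Basis α R M) (b' : Module.Basis β R M')
    (f : M →ₗ[R] M') : Matrix α β R :=
  fun i j => b'.repr (f (b i)) j

lemma rowMatrix_comp {α β γ : Type*} [Fintype β] (b : Module.Basis α R M)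
    (b' : Module.Basis β R M') (b'' : Module.Basis γ R M'') (f : M →ₗ[R] M') (g : M' →ₗ[R] M'') :
    rowMatrix b b'' (g ∘ₗ f) = rowMatrix b b' f * rowMatrix b' b'' g := by
  ext i j
  have h := congrArg (fun z => b''.repr (g z) j) (b'.sum_repr (f (b i)))
  simp only [map_sum, map_smul, Finsupp.coe_finsetSum, Finset.sum_apply, Finsupp.smul_apply,
    smul_eq_mul] at h
  simp only [rowMatrix, Matrix.mul_apply, LinearMap.comp_apply]
  exact h.symm

lemma rowMatrix_id {α : Type*} [DecidableEq α] (b : Module.Basis α R M) :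
    rowMatrix b b LinearMap.id = 1 := by
  ext i j
  simp [rowMatrix, Matrix.one_apply, Finsupp.single_apply]

lemma matrixRank_rowMatrix_le {α β α' β' : Type*} [Fintype α] [Fintype β] [Fintype α'] [Fintype β']
    (b : Module.Basis α R M) (b' : Module.Basis β R M') (c : Module.Basis α' R M)
    (c' : Module.Basis β' R M') (f : M →ₗ[R] M') :
    ρ.matrixRank (rowMatrix b b' f) ≤ ρ.matrixRank (rowMatrix c c' f) := by
  have h : rowMatrix b b' f = rowMatrix b c LinearMap.id *
      (rowMatrix c c' f * rowMatrix c' b' LinearMap.id) := by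
    rw [← rowMatrix_comp, ← rowMatrix_comp]; rfl
  rw [h]
  exact (ρ.matrixRank_mul_le _ _).trans ((min_le_right _ _).trans
    ((ρ.matrixRank_mul_le _ _).trans (min_le_left _ _)))

variable [Module.Free R M] [Module.Finite R M] [Module.Free R M'] [Module.Finite R M']
  [Module.Free R M''] [Module.Finite R M''] [Module.Free R N] [Module.Finite R N]
  [Module.Free R N'] [Module.Finite R N']

/-- The rank of a linear map between finite free left modules: the rank of its matrix in any
bases. -/
noncomputable def linRank (f : M →ₗ[R] M') : ℝ :=
  ρ.matrixRank (rowMatrix (Module.Free.chooseBasis R M) (Module.Free.chooseBasis R M') f)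

lemma linRank_eq_matrixRank {α β : Type*} [Fintype α] [Fintype β] (b : Module.Basis α R M)
    (b' : Module.Basis β R M') (f : M →ₗ[R] M') :
    ρ.linRank f = ρ.matrixRank (rowMatrix b b' f) :=
  le_antisymm (ρ.matrixRank_rowMatrix_le _ _ _ _ f) (ρ.matrixRank_rowMatrix_le _ _ _ _ f)

lemma linRank_zero : ρ.linRank (0 : M →ₗ[R] M') = 0 := by
  have h : rowMatrix (Module.Free.chooseBasis R M) (Module.Free.chooseBasis R M')
      (0 : M →ₗ[R] M') = 0 := by
    ext i j; simp [rowMatrix]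
  unfold linRank matrixRank
  rw [h, Matrix.submatrix_zero]
  exact ρ.rk_zero _ _

lemma linRank_comp_le (g : M' →ₗ[R] M'') (f : M →ₗ[R] M') :
    ρ.linRank (g ∘ₗ f) ≤ min (ρ.linRank f) (ρ.linRank g) := by
  unfold linRank
  rw [rowMatrix_comp _ (Module.Free.chooseBasis R M')]
  exact ρ.matrixRank_mul_le _ _

lemma linRank_comp_le_left (g : M' →ₗ[R] M'') (f : M →ₗ[R] M') :
    ρ.linRank (g ∘ₗ f) ≤ ρ.linRank g :=
  (ρ.linRank_comp_le g f).trans (min_le_right _ _)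

lemma linRank_comp_le_right (g : M' →ₗ[R] M'') (f : M →ₗ[R] M') :
    ρ.linRank (g ∘ₗ f) ≤ ρ.linRank f :=
  (ρ.linRank_comp_le g f).trans (min_le_left _ _)

lemma linRank_id {α : Type*} [Fintype α] (b : Module.Basis α R M) :
    ρ.linRank (LinearMap.id : M →ₗ[R] M) = Fintype.card α := by
  classical
  rw [ρ.linRank_eq_matrixRank b b, rowMatrix_id, matrixRank_one]

lemma linRank_prodMap (f : M →ₗ[R] M') (g : N →ₗ[R] N') :
    ρ.linRank (f.prodMap g) = ρ.linRank f + ρ.linRank g := by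
  rw [ρ.linRank_eq_matrixRank
    ((Module.Free.chooseBasis R M).prod (Module.Free.chooseBasis R N))
    ((Module.Free.chooseBasis R M').prod (Module.Free.chooseBasis R N'))]
  unfold linRank
  rw [← matrixRank_fromBlocks]
  congr 1
  ext (i | i) (j | j) <;> simp [rowMatrix]

lemma linRank_add_le (f g : M →ₗ[R] M') :
    ρ.linRank (f + g) ≤ ρ.linRank f + ρ.linRank g := by
  have h : f + g = (LinearMap.coprod LinearMap.id LinearMap.id) ∘ₗ
      (f.prodMap g ∘ₗ LinearMap.prod LinearMap.id LinearMap.id) := by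
    ext x; simp
  rw [h, ← linRank_prodMap]
  exact (ρ.linRank_comp_le_right _ _).trans (ρ.linRank_comp_le_left _ _)

/-- The projection onto the kernel of a split surjection `r : M → N` has rank at most
`rank M - rank N`. For the idempotent `e = s r` the block-diagonal map `e ⊕ (1 - e)` factors
through `M`, because `e (1 - e) = (1 - e) e = 0`. -/
lemma linRank_id_sub_comp_le (r : M →ₗ[R] N) (s : N →ₗ[R] M) (h : r ∘ₗ s = LinearMap.id) :
    ρ.linRank (LinearMap.id - s ∘ₗ r) ≤
      ρ.linRank (LinearMap.id : M →ₗ[R] M) - ρ.linRank (LinearMap.id : N →ₗ[R] N) := by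
  have hrs : ∀ y, r (s y) = y := fun y => LinearMap.congr_fun h y
  have h1 : (s ∘ₗ r).prodMap (LinearMap.id - s ∘ₗ r) =
      (LinearMap.prod (s ∘ₗ r) (LinearMap.id - s ∘ₗ r)) ∘ₗ (LinearMap.id ∘ₗ
        (LinearMap.coprod (s ∘ₗ r) (LinearMap.id - s ∘ₗ r))) := by
    ext x <;> simp [hrs]
  have h2 := ρ.linRank_prodMap (s ∘ₗ r) (LinearMap.id - s ∘ₗ r)
  have h3 : ρ.linRank ((s ∘ₗ r).prodMap (LinearMap.id - s ∘ₗ r)) ≤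
      ρ.linRank (LinearMap.id : M →ₗ[R] M) := by
    rw [h1]
    exact (ρ.linRank_comp_le_right _ _).trans (ρ.linRank_comp_le_left _ _)
  have h4 : ρ.linRank (LinearMap.id : N →ₗ[R] N) ≤ ρ.linRank (s ∘ₗ r) := by
    have : (LinearMap.id : N →ₗ[R] N) = r ∘ₗ ((s ∘ₗ r) ∘ₗ s) := by
      ext x; simp [hrs]
    rw [this]
    exact (ρ.linRank_comp_le_right _ _).trans (ρ.linRank_comp_le_left _ _)
  linarith

lemma linRank_piMap {k : ℕ} (f : Fin k → (M →ₗ[R] M')) :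
    ρ.linRank (LinearMap.piMap f) = ∑ i, ρ.linRank (f i) := by
  induction k with
  | zero =>
    rw [Subsingleton.elim (LinearMap.piMap f) 0, linRank_zero]; simp
  | succ k ih =>
    rw [Fin.sum_univ_succ, ← ih, ← linRank_prodMap]
    let e := Fin.consLinearEquiv R (fun _ : Fin (k + 1) => M)
    let e' := Fin.consLinearEquiv R (fun _ : Fin (k + 1) => M')
    have h : ∀ z, LinearMap.piMap f (e z) =
        e' ((f 0).prodMap (LinearMap.piMap fun i => f i.succ) z) := by
      intro z
      funext i
      refine Fin.cases ?_ (fun i => ?_) i <;> simp [e, e']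
    apply le_antisymm
    · have h1 : LinearMap.piMap f = e'.toLinearMap ∘ₗ
          ((f 0).prodMap (LinearMap.piMap fun i => f i.succ) ∘ₗ e.symm.toLinearMap) := by
        refine LinearMap.ext fun z => ?_
        have := h (e.symm z)
        simpa using this
      rw [h1]
      exact (ρ.linRank_comp_le_right _ _).trans (ρ.linRank_comp_le_left _ _)
    · have h1 : (f 0).prodMap (LinearMap.piMap fun i => f i.succ) = e'.symm.toLinearMap ∘ₗ
          (LinearMap.piMap f ∘ₗ e.toLinearMap) := by
        refine LinearMap.ext fun z => ?_
        simp only [LinearMap.comp_apply, LinearEquiv.coe_coe, h, LinearEquiv.symm_apply_apply]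
      rw [h1]
      exact (ρ.linRank_comp_le_right _ _).trans (ρ.linRank_comp_le_left _ _)

/-- Right multiplication of row vectors by a matrix, as a map of left modules, has the rank of the
matrix. -/
lemma linRank_toLinearMapRight' {n m : ℕ} (A : Matrix (Fin n) (Fin m) R) :
    ρ.linRank (Matrix.toLinearMapRight' A) = ρ.rk A := by
  rw [ρ.linRank_eq_matrixRank (Pi.basisFun R (Fin n)) (Pi.basisFun R (Fin m)),
    ← ρ.matrixRank_fin]
  congr 1
  ext i j
  simp [rowMatrix, Matrix.toLinearMapRight'_apply]

end LinearMap

end SylvesterRank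

/-! ### Extension of scalars and evaluation of rational functions -/

namespace AmenableExtension

section BaseChange

variable {K E R : Type*} [Field K] [Field E] [Algebra K E] [Ring R] [Algebra K R]

lemma exists_projection (V : Submodule K E) :
    ∃ p : R ⊗[K] E →ₗ[R] V.baseChange R, ∀ w : V.baseChange R, p w = w := by
  obtain ⟨g, hg⟩ := V.subtype.exists_leftInverse_of_injective V.ker_subtype
  refine ⟨V.toBaseChange R ∘ₗ g.baseChange R, ?_⟩
  rintro ⟨w, y, rfl⟩
  have h : g.baseChange R (V.subtype.baseChange R y) = y := by
    rw [← LinearMap.comp_apply, ← LinearMap.baseChange_comp, hg, LinearMap.baseChange_id]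
    rfl
  simp only [LinearMap.comp_apply, h]
  rfl

lemma toBaseChange_injective (V : Submodule K E) : Function.Injective (V.toBaseChange R) := by
  obtain ⟨g, hg⟩ := V.subtype.exists_leftInverse_of_injective V.ker_subtype
  have h : ∀ y, g.baseChange R (V.subtype.baseChange R y) = y := fun y => by
    rw [← LinearMap.comp_apply, ← LinearMap.baseChange_comp, hg, LinearMap.baseChange_id]
    rfl
  intro y z hyz
  rw [← h y, ← h z]
  exact congrArg (g.baseChange R) (congrArg Subtype.val hyz)

/-- A `K`-basis of `V`, viewed as an `R`-basis of `R ⊗ V`. -/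
noncomputable def baseChangeBasis (V : Submodule K E) [FiniteDimensional K V] :
    Module.Basis (Fin (Module.finrank K V)) R (V.baseChange R) :=
  ((Module.finBasis K V).baseChange R).map
    (LinearEquiv.ofBijective (V.toBaseChange R)
      ⟨toBaseChange_injective V, V.toBaseChange_surjective R⟩)

instance (V : Submodule K E) [FiniteDimensional K V] : Module.Free R (V.baseChange R) :=
  Module.Free.of_basis (baseChangeBasis V)

instance (V : Submodule K E) [FiniteDimensional K V] : Module.Finite R (V.baseChange R) :=
  Module.Finite.of_basis (baseChangeBasis V)

/-- A ring with a Sylvester rank function has invariant basis number, so that `freeDim` is the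
size of any basis. -/
lemma freeDim_eq_card {M : Type*} [AddCommGroup M] [Module R M] (ρ : SylvesterRank R) {k : ℕ}
    (b : Module.Basis (Fin k) R M) : freeDim R M = k := by
  have h : {d : ℕ | Nonempty (M ≃ₗ[R] (Fin d → R))} = {k} := by
    ext d
    simp only [Set.mem_ofPred_eq, Set.mem_singleton_iff]
    constructor
    · rintro ⟨e⟩
      have := Module.Free.of_basis b
      have := Module.Finite.of_basis b
      have h1 := ρ.linRank_id b
      rw [ρ.linRank_id (Module.Basis.ofEquivFun e)] at h1
      simpa using h1
    · rintro rfl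
      exact ⟨b.equivFun⟩
  rw [freeDim, h, csInf_singleton]

lemma freeDim_baseChange (ρ : SylvesterRank R) (V : Submodule K E) [FiniteDimensional K V] :
    freeDim R (V.baseChange R) = Module.finrank K V :=
  freeDim_eq_card ρ (baseChangeBasis V)

/-- Right multiplication by the matrix `A`, from `W ^ n` to `W' ^ m` (row vectors). -/
def rightMul {S : Type*} [Ring S] [Module R S] [IsScalarTower R S S] {n m : ℕ}
    (W W' : Submodule R S) (A : Matrix (Fin n) (Fin m) S)
    (h : ∀ i j, ∀ w ∈ W, w * A i j ∈ W') : (Fin n → W) →ₗ[R] (Fin m → W') where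
  toFun w j := ⟨∑ i, (w i : S) * A i j, Submodule.sum_mem _ fun i _ => h i j _ (w i).2⟩
  map_add' v w := by
    funext j; apply Subtype.ext; simp [add_mul, Finset.sum_add_distrib]
  map_smul' r w := by
    funext j; apply Subtype.ext; simp [Finset.smul_sum, smul_mul_assoc]

end BaseChange

section Evaluation

variable {K R : Type*} [Field K] [Ring R] [Algebra K R]

/-- A `K`-linear projection of `K(t)` onto `K[t]`. -/
noncomputable def polyPart (K : Type*) [Field K] : RatFunc K →ₗ[K] Polynomial K :=
  (LinearMap.exists_leftInverse_of_injective
    (IsScalarTower.toAlgHom K (Polynomial K) (RatFunc K)).toLinearMap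
    (LinearMap.ker_eq_bot.2 (IsFractionRing.injective (Polynomial K) (RatFunc K)))).choose

lemma polyPart_algebraMap (p : Polynomial K) :
    polyPart K (algebraMap (Polynomial K) (RatFunc K) p) = p :=
  LinearMap.congr_fun (LinearMap.exists_leftInverse_of_injective
    (IsScalarTower.toAlgHom K (Polynomial K) (RatFunc K)).toLinearMap
    (LinearMap.ker_eq_bot.2 (IsFractionRing.injective (Polynomial K) (RatFunc K)))).choose_spec p

/-- The functional `v ↦ (q v)(x)` for those `v` in `K(t)` for which `q v` is a polynomial, extended
linearly to `K(t)`. Multiplying by a common denominator `q` makes evaluation at poles harmless. -/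
noncomputable def scalarEval (q : Polynomial K) (x : K) : RatFunc K →ₗ[K] K :=
  Polynomial.leval x ∘ₗ polyPart K ∘ₗ
    LinearMap.mulLeft K (algebraMap (Polynomial K) (RatFunc K) q)

lemma scalarEval_eq {q p : Polynomial K} {v : RatFunc K}
    (h : algebraMap (Polynomial K) (RatFunc K) q * v = algebraMap (Polynomial K) (RatFunc K) p)
    (x : K) : scalarEval q x v = p.eval x := by
  simp [scalarEval, h, polyPart_algebraMap, Polynomial.leval]

variable (R) in
/-- The `R`-linear extension of `scalarEval` to `R ⊗ K(t)`. -/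
noncomputable def clearedEval (q : Polynomial K) (x : K) : R ⊗[K] RatFunc K →ₗ[R] R :=
  (TensorProduct.AlgebraTensorModule.rid K R R).toLinearMap ∘ₗ (scalarEval q x).baseChange R

lemma clearedEval_tmul (q : Polynomial K) (x : K) (r : R) (v : RatFunc K) :
    clearedEval R q x (r ⊗ₜ v) = scalarEval q x v • r := by
  simp [clearedEval]

lemma clearedEval_eq_clearedEval_one (q : Polynomial K) (x : K) (w : R ⊗[K] RatFunc K) :
    clearedEval R q x w =
      clearedEval R 1 x (w * 1 ⊗ₜ[K] algebraMap (Polynomial K) (RatFunc K) q) := by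
  induction w with
  | zero => simp
  | add v w hv hw => rw [map_add, add_mul, map_add, hv, hw]
  | tmul r v =>
    rw [Algebra.TensorProduct.tmul_mul_tmul, clearedEval_tmul, clearedEval_tmul, mul_one]
    simp [scalarEval, mul_comm]

lemma polynomialInclusion_monomial (k : ℕ) (a : R) :
    polynomialInclusion K R (Polynomial.monomial k a) = a ⊗ₜ[K] (RatFunc.X ^ k) := by
  change Polynomial.eval₂ _ _ (Polynomial.monomial k a) = _
  rw [Polynomial.eval₂_monomial, Algebra.TensorProduct.tmul_pow]
  simp [Algebra.TensorProduct.tmul_mul_tmul]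

lemma evalAt_monomial (x : K) (k : ℕ) (a : R) :
    evalAt K R x (Polynomial.monomial k a) = x ^ k • a := by
  change Polynomial.eval₂ _ _ (Polynomial.monomial k a) = _
  rw [Polynomial.eval₂_monomial, Algebra.smul_def, map_pow, ← map_pow, Algebra.commutes]
  rfl

lemma clearedEval_one_polynomialInclusion (x : K) (p : Polynomial R) :
    clearedEval R 1 x (polynomialInclusion K R p) = evalAt K R x p := by
  induction p using Polynomial.induction_on' with
  | add p q hp hq => rw [map_add, map_add, map_add, hp, hq]
  | monomial k a =>
    rw [polynomialInclusion_monomial, evalAt_monomial, clearedEval_tmul,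
      scalarEval_eq (p := Polynomial.X ^ k) (by simp)]
    simp

lemma polynomialInclusion_map (p : Polynomial K) :
    polynomialInclusion K R (p.map (algebraMap K R)) =
      1 ⊗ₜ[K] algebraMap (Polynomial K) (RatFunc K) p := by
  induction p using Polynomial.induction_on' with
  | add p q hp hq => rw [Polynomial.map_add, map_add, map_add, hp, hq, TensorProduct.tmul_add]
  | monomial k a =>
    rw [Polynomial.map_monomial, polynomialInclusion_monomial, Algebra.algebraMap_eq_smul_one,
      TensorProduct.smul_tmul, ← Polynomial.C_mul_X_pow_eq_monomial]
    simp [RatFunc.algebraMap_C, RatFunc.smul_eq_C_mul]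

lemma one_tmul_commute (e : RatFunc K) (s : R ⊗[K] RatFunc K) :
    s * 1 ⊗ₜ[K] e = 1 ⊗ₜ[K] e * s := by
  induction s with
  | zero => simp
  | add v w hv hw => rw [add_mul, mul_add, hv, hw]
  | tmul r v => simp [Algebra.TensorProduct.tmul_mul_tmul, mul_comm]

lemma exists_polynomialInclusion_eq {V : Submodule K (RatFunc K)} {q : Polynomial K}
    (hq : ∀ v ∈ V, ∃ p : Polynomial K, algebraMap (Polynomial K) (RatFunc K) q * v =
      algebraMap (Polynomial K) (RatFunc K) p)
    {w : R ⊗[K] RatFunc K} (hw : w ∈ V.baseChange R) :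
    ∃ p : Polynomial R, w * 1 ⊗ₜ[K] algebraMap (Polynomial K) (RatFunc K) q =
      polynomialInclusion K R p := by
  obtain ⟨y, rfl⟩ := hw
  induction y with
  | zero => exact ⟨0, by simp⟩
  | add v w hv hw =>
    obtain ⟨a, ha⟩ := hv
    obtain ⟨b, hb⟩ := hw
    exact ⟨a + b, by rw [map_add, add_mul, ha, hb, map_add]⟩
  | tmul r v =>
    obtain ⟨p, hp⟩ := hq v v.2
    refine ⟨Polynomial.C r * p.map (algebraMap K R), ?_⟩
    rw [map_mul, polynomialInclusion_map, ← Polynomial.monomial_zero_left,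
      polynomialInclusion_monomial, ← hp]
    simp [Algebra.TensorProduct.tmul_mul_tmul, mul_comm]

/-- Cleared evaluation turns right multiplication by a polynomial over `R` into right
multiplication by its value. -/
lemma clearedEval_mul_polynomialInclusion {V : Submodule K (RatFunc K)} {q : Polynomial K}
    (hq : ∀ v ∈ V, ∃ p : Polynomial K, algebraMap (Polynomial K) (RatFunc K) q * v =
      algebraMap (Polynomial K) (RatFunc K) p)
    {w : R ⊗[K] RatFunc K} (hw : w ∈ V.baseChange R) (x : K) (a : Polynomial R) :
    clearedEval R q x (w * polynomialInclusion K R a) =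
      clearedEval R q x w * evalAt K R x a := by
  obtain ⟨p, hp⟩ := exists_polynomialInclusion_eq hq hw
  rw [clearedEval_eq_clearedEval_one, mul_assoc, one_tmul_commute, ← mul_assoc, hp, ← map_mul,
    clearedEval_eq_clearedEval_one q x w, hp, clearedEval_one_polynomialInclusion,
    clearedEval_one_polynomialInclusion, map_mul]

lemma exists_common_denominator (V : Submodule K (RatFunc K)) [FiniteDimensional K V] :
    ∃ q : Polynomial K, q ≠ 0 ∧ ∀ v ∈ V, ∃ p : Polynomial K,
      algebraMap (Polynomial K) (RatFunc K) q * v = algebraMap (Polynomial K) (RatFunc K) p := by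
  obtain ⟨s, hs⟩ := (Submodule.fg_iff_finiteDimensional V).2 inferInstance
  obtain ⟨b, hb⟩ := IsLocalization.exist_integer_multiples_of_finset
    (nonZeroDivisors (Polynomial K)) (S := RatFunc K) s
  refine ⟨b, nonZeroDivisors.ne_zero b.2, fun v hv => ?_⟩
  rw [← hs] at hv
  induction hv using Submodule.span_induction with
  | mem v hv =>
    obtain ⟨p, hp⟩ := hb v hv
    exact ⟨p, by rw [hp, Algebra.smul_def]⟩
  | zero => exact ⟨0, by simp⟩
  | add v w _ _ hv hw =>
    obtain ⟨p, hp⟩ := hv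
    obtain ⟨p', hp'⟩ := hw
    exact ⟨p + p', by rw [mul_add, hp, hp', map_add]⟩
  | smul a v _ hv =>
    obtain ⟨p, hp⟩ := hv
    refine ⟨a • p, ?_⟩
    rw [mul_smul_comm, hp, ← Polynomial.C_mul', map_mul, RatFunc.algebraMap_C,
      RatFunc.smul_eq_C_mul]

/-- A finite-dimensional space of rational functions is coordinatized by evaluation at suitable
points of any given infinite set. -/
lemma exists_evaluation_equiv (V : Submodule K (RatFunc K)) [FiniteDimensional K V]
    {q : Polynomial K} (hq0 : q ≠ 0)
    (hq : ∀ v ∈ V, ∃ p : Polynomial K, algebraMap (Polynomial K) (RatFunc K) q * v =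
      algebraMap (Polynomial K) (RatFunc K) p)
    {x : ℕ → K} (hx : Function.Injective x) {T : Set ℕ} (hT : T.Infinite) :
    ∃ k : Fin (Module.finrank K V) → ℕ, (∀ i, k i ∈ T) ∧
      ∃ e : V ≃ₗ[K] (Fin (Module.finrank K V) → K),
        ∀ v i, e v i = scalarEval q (x (k i)) v := by
  let ev : ℕ → Module.Dual K V := fun i => scalarEval q (x i) ∘ₗ V.subtype
  have hsep : ∀ v : V, (∀ i ∈ T, ev i v = 0) → v = 0 := by
    intro v hv
    obtain ⟨p, hp⟩ := hq v v.2
    have hp0 : p = 0 := by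
      refine Polynomial.eq_zero_of_infinite_isRoot p ?_
      refine (hT.image hx.injOn).mono ?_
      rintro _ ⟨i, hi, rfl⟩
      have := hv i hi
      rwa [show ev i v = p.eval (x i) from scalarEval_eq hp (x i)] at this
    rw [hp0, map_zero, mul_eq_zero] at hp
    rcases hp with h | h
    · exact absurd ((map_eq_zero_iff _ (IsFractionRing.injective _ _)).1 h) hq0
    · exact Subtype.ext h
  have hspan : Submodule.span K (ev '' T) = ⊤ := by
    rw [← Subspace.dualCoannihilator_dualAnnihilator_eq (W := Submodule.span K (ev '' T)),
      ← Submodule.dualAnnihilator_bot]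
    congr 1
    rw [eq_bot_iff]
    intro v hv
    refine hsep v fun i hi => ?_
    exact (Submodule.mem_dualCoannihilator v).1 hv _ (Submodule.subset_span ⟨i, hi, rfl⟩)
  obtain ⟨f, hf, hfs, -⟩ := Submodule.exists_fun_fin_finrank_span_eq K (ev '' T)
  have hd : Module.finrank K (Submodule.span K (ev '' T)) = Module.finrank K V := by
    rw [hspan, finrank_top, Subspace.dual_finrank_eq]
  replace hfs := hfs.trans hspan
  choose k hkT hk using hf
  let g : V →ₗ[K] (Fin (Module.finrank K V) → K) := LinearMap.pi fun i => f (Fin.cast hd.symm i)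
  have hg : Function.Injective g := by
    rw [← LinearMap.ker_eq_bot, eq_bot_iff]
    intro v hv
    have h0 : ∀ i, f i v = 0 := fun i => congrFun (LinearMap.mem_ker.1 hv) (Fin.cast hd i)
    have h1 : ∀ φ ∈ Submodule.span K (Set.range f), φ v = 0 := by
      intro φ hφ
      induction hφ using Submodule.span_induction with
      | mem φ h => obtain ⟨i, rfl⟩ := h; exact h0 i
      | zero => rfl
      | add φ ψ _ _ h h' => rw [LinearMap.add_apply, h, h', add_zero]
      | smul a φ _ h => rw [LinearMap.smul_apply, h, smul_zero]
    exact hsep v fun i _ => h1 _ (hfs ▸ Submodule.mem_top)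
  refine ⟨fun i => k (Fin.cast hd.symm i), fun i => hkT _,
    LinearEquiv.ofInjectiveOfFinrankEq g hg (by simp), fun v i => ?_⟩
  change f (Fin.cast hd.symm i) v = _
  rw [← hk]
  rfl

/-- Interpolation at the points `y i`, with coefficients extended to `R`. -/
lemma exists_interpolation {V : Submodule K (RatFunc K)} {N : ℕ} {q : Polynomial K} {y : Fin N → K}
    (e : V ≃ₗ[K] (Fin N → K)) (he : ∀ v i, e v i = scalarEval q (y i) v) :
    ∃ s : (Fin N → R) →ₗ[R] V.baseChange R,
      ∀ c i, clearedEval R q (y i) (s c : R ⊗[K] RatFunc K) = c i := by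
  classical
  let d : Fin N → V := fun i => e.symm (Pi.single i 1)
  let s : (Fin N → R) →ₗ[R] V.baseChange R := Fintype.linearCombination R
    fun i => (⟨1 ⊗ₜ[K] (d i : RatFunc K), Submodule.tmul_mem_baseChange_of_mem 1 (d i).2⟩ :
      V.baseChange R)
  have hs : ∀ c, (s c : R ⊗[K] RatFunc K) = ∑ i, c i • (1 : R) ⊗ₜ[K] (d i : RatFunc K) := by
    intro c
    simp [s, Fintype.linearCombination_apply]
  refine ⟨s, fun c i => ?_⟩
  rw [hs, map_sum, Finset.sum_eq_single i]
  · rw [map_smul, clearedEval_tmul, ← he]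
    simp [d]
  · intro j _ hj
    rw [map_smul, clearedEval_tmul, ← he]
    simp [d, hj.symm]
  · simp

end Evaluation

end AmenableExtension

/-! ### Local ranks and ranks of evaluated matrices -/

namespace AmenableExtension

section LocalRank

variable {K E R : Type*} [Field K] [Field E] [Algebra K E] [Ring R] [Algebra K R]
  (ρ : SylvesterRank R) {n m : ℕ}

/-- The rank of right multiplication by `A` on `(R ⊗ V) ^ n` does not depend on the codomain: two
codomains are compared by means of a projection of `R ⊗ E` onto one of them. -/
lemma linRank_rightMul_le (V V' V'' : Submodule K E) [FiniteDimensional K V]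
    [FiniteDimensional K V'] [FiniteDimensional K V''] (A : Matrix (Fin n) (Fin m) (R ⊗[K] E))
    (h' : ∀ i j, ∀ w ∈ V.baseChange R, w * A i j ∈ V'.baseChange R)
    (h'' : ∀ i j, ∀ w ∈ V.baseChange R, w * A i j ∈ V''.baseChange R) :
    ρ.linRank (rightMul _ _ A h') ≤ ρ.linRank (rightMul _ _ A h'') := by
  obtain ⟨p, hp⟩ := exists_projection (R := R) V'
  have h : rightMul _ _ A h' = (LinearMap.piMap fun _ : Fin m =>
      p ∘ₗ (V''.baseChange R).subtype) ∘ₗ rightMul _ _ A h'' := by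
    refine LinearMap.ext fun w => funext fun j => ?_
    exact (hp (rightMul _ _ A h' w j)).symm
  rw [h]
  exact ρ.linRank_comp_le_right _ _

lemma IsLocalRank.eq_linRank {V : Submodule K E} [FiniteDimensional K V]
    {hV : V.baseChange R ∈ fieldSystem K E R ∧ V.baseChange R ≠ ⊥}
    {V'' : Submodule K E} [FiniteDimensional K V''] {A : Matrix (Fin n) (Fin m) (R ⊗[K] E)}
    (h : ∀ i j, ∀ w ∈ V.baseChange R, w * A i j ∈ V''.baseChange R) {r : ℝ}
    (hr : IsLocalRank ρ (fieldSystem K E R) ⟨V.baseChange R, hV⟩ A r) :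
    r = ρ.linRank (rightMul _ _ A h) := by
  obtain ⟨⟨_, ⟨V', hfd, rfl⟩, hne⟩, h', l, p, b, b', B, hB, rfl⟩ := hr
  have h1 : ρ.linRank (rightMul _ _ A h') = ρ.rk B := by
    rw [ρ.linRank_eq_matrixRank b b', ← ρ.matrixRank_fin]
    congr 1
    have h2 : ∀ a, rightMul _ _ A h' (b a) = ∑ c, B a c • b' c := by
      intro a
      funext j
      apply Subtype.ext
      have h3 := congrFun (hB a) j
      simp only [Matrix.vecMul, dotProduct, Finset.sum_apply, Pi.smul_apply] at h3
      simpa [rightMul, Finset.sum_apply] using h3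
    ext a c
    rw [SylvesterRank.rowMatrix, h2, b'.repr_sum_self]
  rw [← h1]
  exact le_antisymm (linRank_rightMul_le ρ _ _ _ A h' h) (linRank_rightMul_le ρ _ _ _ A h h')

/-- The local rank is the rank of right multiplication into any member of the system that is large
enough to contain the products. -/
lemma localRank_eq_linRank {V : Submodule K E} [FiniteDimensional K V]
    {hV : V.baseChange R ∈ fieldSystem K E R ∧ V.baseChange R ≠ ⊥}
    {V'' : Submodule K E} [FiniteDimensional K V''] (hle : V.baseChange R ≤ V''.baseChange R)
    {A : Matrix (Fin n) (Fin m) (R ⊗[K] E)}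
    (h : ∀ i j, ∀ w ∈ V.baseChange R, w * A i j ∈ V''.baseChange R) :
    localRank ρ (fieldSystem K E R) ⟨V.baseChange R, hV⟩ A = ρ.linRank (rightMul _ _ A h) := by
  refine IsLocalRank.eq_linRank ρ (hV := hV) h (Classical.epsilon_spec
    (p := IsLocalRank ρ (fieldSystem K E R) ⟨V.baseChange R, hV⟩ A)
    ⟨ρ.linRank (rightMul _ _ A h), ?_⟩)
  have hne : V''.baseChange R ≠ ⊥ := fun h0 => hV.2 (le_bot_iff.1 (h0 ▸ hle))
  let b := (Module.Free.chooseBasis R (Fin n → V.baseChange R)).reindex (Fintype.equivFin _)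
  let b' := (Module.Free.chooseBasis R (Fin m → V''.baseChange R)).reindex (Fintype.equivFin _)
  refine ⟨⟨V''.baseChange R, ⟨V'', inferInstance, rfl⟩, hne⟩, h, _, _, b, b',
    SylvesterRank.rowMatrix b b' (rightMul _ _ A h), fun a => ?_, ?_⟩
  · have h1 := b'.sum_repr (rightMul _ _ A h (b a))
    funext j
    have h2 := congrArg Subtype.val (congrFun h1 j)
    simp only [Finset.sum_apply, Pi.smul_apply, AddSubmonoidClass.coe_finsetSum,
      SetLike.val_smul] at h2 ⊢
    exact h2.symm
  · rw [ρ.linRank_eq_matrixRank b b', ρ.matrixRank_fin]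

end LocalRank

section Sandwich

variable {K R : Type*} [Field K] [Ring R] [Algebra K R] (ρ : SylvesterRank R)

/-- Cleared evaluation at the points `y i` of a vector with entries in `R ⊗ V`. -/
noncomputable def vectorEval {N : ℕ} (q : Polynomial K) (y : Fin N → K)
    (V : Submodule K (RatFunc K)) (p : ℕ) :
    (Fin p → V.baseChange R) →ₗ[R] (Fin N → Fin p → R) :=
  LinearMap.pi fun i => LinearMap.pi fun j =>
    clearedEval R q (y i) ∘ₗ (V.baseChange R).subtype ∘ₗ LinearMap.proj j

/-- Right multiplication by a matrix `A` over `R[t]` on `(R ⊗ V) ^ n`, evaluated at `dim V` suitable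
points, becomes the direct sum of the right multiplications by the values of `A`. The evaluation map
is bijective on `R ⊗ V`, and on a larger `R ⊗ V''` it is a split surjection with kernel of rank
`dim V'' - dim V`. -/
theorem exists_points_linRank_rightMul_bounds {x : ℕ → K} (hx : Function.Injective x)
    {V V'' : Submodule K (RatFunc K)} [FiniteDimensional K V] [FiniteDimensional K V'']
    (hle : V.baseChange R ≤ V''.baseChange R) {n m : ℕ}
    (A : Matrix (Fin n) (Fin m) (Polynomial R))
    (h : ∀ i j, ∀ w ∈ V.baseChange R,
      w * A.map (polynomialInclusion K R) i j ∈ V''.baseChange R)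
    {T : Set ℕ} (hT : T.Infinite) :
    ∃ k : Fin (Module.finrank K V) → ℕ, (∀ i, k i ∈ T) ∧
      ∑ i, ρ.rk (A.map (evalAt K R (x (k i)))) ≤ ρ.linRank (rightMul _ _ _ h) ∧
      ρ.linRank (rightMul _ _ _ h) ≤ ∑ i, ρ.rk (A.map (evalAt K R (x (k i)))) +
        m * ((Module.finrank K V'' : ℝ) - Module.finrank K V) := by
  obtain ⟨q, hq0, hq⟩ := exists_common_denominator V
  obtain ⟨k, hkT, e, he⟩ := exists_evaluation_equiv V hq0 hq hx hT
  obtain ⟨s, hs⟩ := exists_interpolation (R := R) e he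
  let N := Module.finrank K V
  let y : Fin N → K := fun i => x (k i)
  let μ := rightMul _ _ _ h
  let D : (Fin N → Fin n → R) →ₗ[R] (Fin N → Fin m → R) :=
    LinearMap.piMap fun i => Matrix.toLinearMapRight' (A.map (evalAt K R (y i)))
  have hD : ρ.linRank D = ∑ i, ρ.rk (A.map (evalAt K R (x (k i)))) := by
    simp only [D, ρ.linRank_piMap, ρ.linRank_toLinearMapRight', y]
    rfl
  let interp : ∀ p : ℕ, (Fin N → Fin p → R) →ₗ[R] (Fin p → V.baseChange R) := fun p =>
    LinearMap.pi fun j => s ∘ₗ LinearMap.pi fun i => LinearMap.proj j ∘ₗ LinearMap.proj i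
  let Φ := vectorEval (R := R) q y V n
  let Φ' := vectorEval (R := R) q y V'' m
  let σ : (Fin N → Fin m → R) →ₗ[R] (Fin m → V''.baseChange R) :=
    (LinearMap.piMap fun _ => Submodule.inclusion hle) ∘ₗ interp m
  have hΦ : Φ ∘ₗ interp n = LinearMap.id := by
    refine LinearMap.ext fun c => funext fun i => funext fun j => ?_
    exact hs (fun i => c i j) i
  have hσ : Φ' ∘ₗ σ = LinearMap.id := by
    refine LinearMap.ext fun c => funext fun i => funext fun j => ?_
    exact hs (fun i => c i j) i
  have hcomm : Φ' ∘ₗ μ = D ∘ₗ Φ := by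
    refine LinearMap.ext fun w => funext fun i => funext fun j => ?_
    change clearedEval R q (y i) (∑ a, (w a : R ⊗[K] RatFunc K) *
        polynomialInclusion K R (A a j)) =
      ∑ a, clearedEval R q (y i) (w a : R ⊗[K] RatFunc K) * evalAt K R (y i) (A a j)
    rw [map_sum]
    exact Finset.sum_congr rfl fun a _ =>
      clearedEval_mul_polynomialInclusion hq (w a).2 (y i) (A a j)
  refine ⟨k, hkT, ?_, ?_⟩
  · have h1 : D = Φ' ∘ₗ (μ ∘ₗ interp n) := by
      rw [← LinearMap.comp_assoc, hcomm, LinearMap.comp_assoc, hΦ, LinearMap.comp_id]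
    rw [← hD, h1]
    exact (ρ.linRank_comp_le_right _ _).trans (ρ.linRank_comp_le_left _ _)
  · have h1 : μ = σ ∘ₗ (D ∘ₗ Φ) + (LinearMap.id - σ ∘ₗ Φ') ∘ₗ μ := by
      rw [← hcomm, LinearMap.sub_comp, LinearMap.id_comp]
      exact (add_sub_cancel (σ ∘ₗ (Φ' ∘ₗ μ)) μ).symm
    have h2 : ρ.linRank (σ ∘ₗ (D ∘ₗ Φ)) ≤ ρ.linRank D :=
      (ρ.linRank_comp_le_right _ _).trans (ρ.linRank_comp_le_left _ _)
    have h3 := (ρ.linRank_comp_le_left (LinearMap.id - σ ∘ₗ Φ') μ).trans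
      (ρ.linRank_id_sub_comp_le Φ' σ hσ)
    rw [ρ.linRank_id (Pi.basis fun _ : Fin m => baseChangeBasis (R := R) V''),
      ρ.linRank_id (Pi.basis fun _ : Fin N => Pi.basisFun R (Fin m))] at h3
    have h4 := ρ.linRank_add_le (σ ∘ₗ (D ∘ₗ Φ)) ((LinearMap.id - σ ∘ₗ Φ') ∘ₗ μ)
    rw [← h1] at h4
    simp only [Fintype.card_sigma, Fintype.card_fin, Finset.sum_const, Finset.card_univ,
      smul_eq_mul, Nat.cast_mul] at h3
    change ρ.linRank μ ≤ _
    rw [← hD]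
    linarith

/-- For a sufficiently invariant `W`, every infinite set of evaluation points controls
`rk_W(A) / dim W`: uniform bounds for the ranks of the values of `A` on that set pass to it, up to
a small error in the upper bound. -/
lemma eventually_normalizedRank_bounds {x : ℕ → K} (hx : Function.Injective x)
    {ω : Ultrafilter (Hat (fieldSystem K (RatFunc K) R))} (hω : IsNonprincipal ω) {n m : ℕ}
    (A : Matrix (Fin n) (Fin m) (Polynomial R)) {ε : ℝ} (hε : 0 < ε) :
    ∀ᶠ W in (ω : Filter (Hat (fieldSystem K (RatFunc K) R))),
      ∀ T : Set ℕ, T.Infinite → ∀ c : ℝ,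
        ((∀ i ∈ T, c ≤ ρ.rk (A.map (evalAt K R (x i)))) →
          c ≤ normalizedRank ρ (fieldSystem K (RatFunc K) R)
            (A.map (polynomialInclusion K R)) W) ∧
        ((∀ i ∈ T, ρ.rk (A.map (evalAt K R (x i))) ≤ c) →
          normalizedRank ρ (fieldSystem K (RatFunc K) R)
            (A.map (polynomialInclusion K R)) W ≤ c + m * ε) := by
  classical
  let P : Finset (R ⊗[K] RatFunc K) := Finset.univ.image
    fun ij : Fin n × Fin m => A.map (polynomialInclusion K R) ij.1 ij.2
  filter_upwards [hω P ε hε] with W hW T hT c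
  obtain ⟨_, ⟨V, hV, rfl⟩, hne⟩ := W
  obtain ⟨_, ⟨V'', hV'', rfl⟩, hle, hmul, hdim⟩ := hW
  rw [freeDim_baseChange ρ, freeDim_baseChange ρ] at hdim
  have h : ∀ i j, ∀ w ∈ V.baseChange R,
      w * A.map (polynomialInclusion K R) i j ∈ V''.baseChange R := fun i j w hw =>
    hmul w hw _ (Finset.mem_image.2 ⟨(i, j), Finset.mem_univ _, rfl⟩)
  obtain ⟨k, hkT, h1, h2⟩ := exists_points_linRank_rightMul_bounds ρ hx hle A h hT
  have hN : 0 < Module.finrank K V := by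
    rw [Module.finrank_pos_iff_exists_ne_zero]
    by_contra! h0
    apply hne
    rw [(Submodule.eq_bot_iff V).2 fun v hv => congrArg Subtype.val (h0 ⟨v, hv⟩),
      Submodule.baseChange_bot]
  have hN' : (0 : ℝ) < Module.finrank K V := by exact_mod_cast hN
  rw [normalizedRank, localRank_eq_linRank ρ hle h, freeDim_baseChange ρ]
  constructor
  · intro hc
    rw [le_div_iff₀ hN']
    have h3 := Finset.card_nsmul_le_sum Finset.univ
      (fun i => ρ.rk (A.map (evalAt K R (x (k i))))) c fun i _ => hc _ (hkT i)
    rw [Finset.card_univ, Fintype.card_fin, nsmul_eq_mul] at h3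
    linarith
  · intro hc
    rw [div_le_iff₀ hN']
    have h3 := Finset.sum_le_card_nsmul Finset.univ
      (fun i => ρ.rk (A.map (evalAt K R (x (k i))))) c fun i _ => hc _ (hkT i)
    rw [Finset.card_univ, Fintype.card_fin, nsmul_eq_mul] at h3
    have h4 : (m : ℝ) * ((Module.finrank K V'' : ℝ) - Module.finrank K V) ≤
        m * (ε * Module.finrank K V) :=
      mul_le_mul_of_nonneg_left (by linarith) (Nat.cast_nonneg m)
    linarith

/-- Both limits exist and agree. If infinitely many values of `A` had rank at least `c > L` or at
most `c < L`, then evaluating at these points only would keep `rk_W(A) / dim W` away from its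
limit `L`. -/
theorem exists_tendsto_normalizedRank_and_rk {x : ℕ → K} (hx : Function.Injective x)
    {ω : Ultrafilter (Hat (fieldSystem K (RatFunc K) R))} (hω : IsNonprincipal ω) {n m : ℕ}
    (A : Matrix (Fin n) (Fin m) (Polynomial R)) :
    ∃ L : ℝ, Tendsto (normalizedRank ρ (fieldSystem K (RatFunc K) R)
        (A.map (polynomialInclusion K R))) ω (𝓝 L) ∧
      Tendsto (fun i : ℕ => ρ.rk (A.map (evalAt K R (x i)))) atTop (𝓝 L) := by
  set r := normalizedRank ρ (fieldSystem K (RatFunc K) R) (A.map (polynomialInclusion K R))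
  have hmem : ∀ᶠ W in (ω : Filter (Hat (fieldSystem K (RatFunc K) R))),
      r W ∈ Set.Icc (0 : ℝ) (n + m * 1) := by
    filter_upwards [eventually_normalizedRank_bounds ρ hx hω A one_pos] with W hW
    exact ⟨(hW _ Set.infinite_univ 0).1 fun i _ => ρ.rk_nonneg _,
      (hW _ Set.infinite_univ n).2 fun i _ => ρ.rk_le_rows _⟩
  obtain ⟨L, -, hL⟩ := isCompact_Icc.ultrafilter_le_nhds (ω.map r)
    (le_principal_iff.2 (Ultrafilter.mem_coe.2 (Ultrafilter.mem_map.2 hmem)))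
  have hL' : Tendsto r ω (𝓝 L) := hL
  refine ⟨L, hL', ?_⟩
  rw [tendsto_order]
  constructor
  · intro c hc
    by_contra hfr
    have hT : {i : ℕ | ρ.rk (A.map (evalAt K R (x i))) ≤ c}.Infinite := by
      rw [not_eventually] at hfr
      simpa only [not_lt] using Nat.frequently_atTop_iff_infinite.1 hfr
    -- With `ε = (L - c) / (2 * (m + 1))` the error `m * ε` is less than the gap `L - c`.
    have hε : 0 < (L - c) / (2 * (m + 1)) := div_pos (by linarith) (by positivity)
    have hlt : (m : ℝ) * ((L - c) / (2 * (m + 1))) < L - c := by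
      rw [← mul_div_assoc, div_lt_iff₀ (by positivity)]
      nlinarith [Nat.cast_nonneg (α := ℝ) m]
    have h1 : L ≤ c + m * ((L - c) / (2 * (m + 1))) := le_of_tendsto hL' <| by
      filter_upwards [eventually_normalizedRank_bounds ρ hx hω A hε] with W hW
      exact (hW _ hT c).2 fun i hi => hi
    linarith
  · intro c hc
    by_contra hfr
    have hT : {i : ℕ | c ≤ ρ.rk (A.map (evalAt K R (x i)))}.Infinite := by
      rw [not_eventually] at hfr
      simpa only [not_lt] using Nat.frequently_atTop_iff_infinite.1 hfr
    have h1 : c ≤ L := ge_of_tendsto hL' <| by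
      filter_upwards [eventually_normalizedRank_bounds ρ hx hω A one_pos] with W hW
      exact (hW _ hT c).1 fun i hi => hi
    linarith

end Sandwich

end AmenableExtension

/-! ### Existence of non-principal ultrafilters -/

namespace AmenableExtension

section Existence

variable {K R : Type*} [Field K] [Ring R] [Algebra K R]

lemma mul_mem_baseChange {E : Type*} [Field E] [Algebra K E] {V U V' : Submodule K E}
    (h : ∀ v ∈ V, ∀ u ∈ U, v * u ∈ V') {w s : R ⊗[K] E} (hw : w ∈ V.baseChange R)
    (hs : s ∈ U.baseChange R) : w * s ∈ V'.baseChange R := by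
  obtain ⟨y, rfl⟩ := hw
  obtain ⟨z, rfl⟩ := hs
  induction y with
  | zero => simp
  | add a b ha hb => rw [map_add, add_mul]; exact Submodule.add_mem _ ha hb
  | tmul r v =>
    induction z with
    | zero => simp
    | add a b ha hb => rw [map_add, mul_add]; exact Submodule.add_mem _ ha hb
    | tmul r' u =>
      rw [LinearMap.baseChange_tmul, LinearMap.baseChange_tmul,
        Algebra.TensorProduct.tmul_mul_tmul]
      exact Submodule.tmul_mem_baseChange_of_mem (A := R) (r * r') (h v v.2 u u.2)

lemma exists_finiteDimensional_mem_baseChange {E : Type*} [Field E] [Algebra K E]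
    (P : Finset (R ⊗[K] E)) :
    ∃ U : Submodule K E, FiniteDimensional K U ∧ ∀ s ∈ P, s ∈ U.baseChange R := by
  classical
  have h1 : ∀ s : R ⊗[K] E, ∃ U : Submodule K E, FiniteDimensional K U ∧ s ∈ U.baseChange R := by
    intro s
    induction s with
    | zero => exact ⟨⊥, inferInstance, Submodule.zero_mem _⟩
    | add a b ha hb =>
      obtain ⟨U, hU, ha⟩ := ha
      obtain ⟨U', hU', hb⟩ := hb
      exact ⟨U ⊔ U', inferInstance, Submodule.add_mem _
        (Submodule.baseChange_mono R le_sup_left ha) (Submodule.baseChange_mono R le_sup_right hb)⟩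
    | tmul r e =>
      exact ⟨Submodule.span K {e}, inferInstance,
        Submodule.tmul_mem_baseChange_of_mem _ (Submodule.mem_span_singleton_self e)⟩
  choose U hU hmem using h1
  exact ⟨P.sup U, Submodule.finiteDimensional_finset_sup P U, fun s hs =>
    Submodule.baseChange_mono R (Finset.le_sup hs) (hmem s)⟩

lemma mul_mem_degreeLT {p r : Polynomial K} {N d : ℕ} (hp : p ∈ Polynomial.degreeLT K N)
    (hr : r ∈ Polynomial.degreeLT K d) : r * p ∈ Polynomial.degreeLT K (N + d) := by
  by_cases hp0 : p = 0
  · simp [hp0]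
  by_cases hr0 : r = 0
  · simp [hr0]
  rw [Polynomial.mem_degreeLT] at *
  rw [← Polynomial.natDegree_lt_iff_degree_lt (by assumption)] at hp hr
  rw [← Polynomial.natDegree_lt_iff_degree_lt (mul_ne_zero hr0 hp0),
    Polynomial.natDegree_mul hr0 hp0]
  omega

/-- The polynomials of degree less than `N`, as a space of rational functions, divided by `q`. -/
noncomputable def boundedDegree (q : Polynomial K) (N : ℕ) : Submodule K (RatFunc K) :=
  (Polynomial.degreeLT K N).map
    (LinearMap.mulLeft K (algebraMap (Polynomial K) (RatFunc K) q)⁻¹ ∘ₗ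
      (IsScalarTower.toAlgHom K (Polynomial K) (RatFunc K)).toLinearMap)

instance (N : ℕ) : FiniteDimensional K (Polynomial.degreeLT K N) :=
  Module.Finite.equiv (Polynomial.degreeLTEquiv K N).symm

instance (q : Polynomial K) (N : ℕ) : FiniteDimensional K (boundedDegree q N) := by
  unfold boundedDegree; infer_instance

lemma finrank_boundedDegree {q : Polynomial K} (hq : q ≠ 0) (N : ℕ) :
    Module.finrank K (boundedDegree q N) = N := by
  have hq' : (algebraMap (Polynomial K) (RatFunc K) q)⁻¹ ≠ 0 :=
    inv_ne_zero ((map_ne_zero_iff _ (IsFractionRing.injective _ _)).2 hq)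
  have hinj : Function.Injective
      (LinearMap.mulLeft K (algebraMap (Polynomial K) (RatFunc K) q)⁻¹ ∘ₗ
        (IsScalarTower.toAlgHom K (Polynomial K) (RatFunc K)).toLinearMap) :=
    fun a b hab => IsFractionRing.injective (Polynomial K) (RatFunc K)
      (mul_left_cancel₀ hq' hab)
  rw [boundedDegree, ← (Submodule.equivMapOfInjective _ hinj _).finrank_eq,
    (Polynomial.degreeLTEquiv K N).finrank_eq, Module.finrank_fin_fun]

lemma mem_boundedDegree {q : Polynomial K} (hq : q ≠ 0) {N : ℕ} {v : RatFunc K}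
    {p : Polynomial K} (hp : p ∈ Polynomial.degreeLT K N)
    (h : algebraMap (Polynomial K) (RatFunc K) q * v =
      algebraMap (Polynomial K) (RatFunc K) p) : v ∈ boundedDegree q N := by
  have hq' : algebraMap (Polynomial K) (RatFunc K) q ≠ 0 :=
    (map_ne_zero_iff _ (IsFractionRing.injective _ _)).2 hq
  refine ⟨p, hp, ?_⟩
  change (algebraMap (Polynomial K) (RatFunc K) q)⁻¹ * algebraMap (Polynomial K) (RatFunc K) p = v
  rw [← h, inv_mul_cancel_left₀ hq']

lemma exists_le_degreeLT (U : Submodule K (Polynomial K)) [FiniteDimensional K U] :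
    ∃ d, U ≤ Polynomial.degreeLT K d := by
  obtain ⟨s, hs⟩ := (Submodule.fg_iff_finiteDimensional U).2 inferInstance
  refine ⟨s.sup Polynomial.natDegree + 1, ?_⟩
  rw [← hs, Submodule.span_le]
  intro p hp
  rw [SetLike.mem_coe, Polynomial.mem_degreeLT]
  refine lt_of_le_of_lt Polynomial.degree_le_natDegree ?_
  exact_mod_cast Nat.lt_succ_of_le (Finset.le_sup (f := Polynomial.natDegree) hp)

/-- Polynomials of degree less than `N`, for large `N`, form an invariant member of the system: the
products with a finite set lie in `q⁻¹ K[t]_{< N + d}` with `q` and `d` independent of `N`. -/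
lemma exists_isInvariant (ρ : SylvesterRank R) (P : Finset (R ⊗[K] RatFunc K)) {ε : ℝ}
    (hε : 0 < ε) :
    ∃ W : Hat (fieldSystem K (RatFunc K) R), IsInvariant (fieldSystem K (RatFunc K) R) P ε W := by
  obtain ⟨U, hU, hPU⟩ := exists_finiteDimensional_mem_baseChange P
  obtain ⟨q, hq0, hq⟩ := exists_common_denominator U
  obtain ⟨d, hd⟩ := exists_le_degreeLT (Submodule.span K {q} ⊔ U.map (polyPart K ∘ₗ
    LinearMap.mulLeft K (algebraMap (Polynomial K) (RatFunc K) q)))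
  have hqd : q ∈ Polynomial.degreeLT K d :=
    hd (Submodule.mem_sup_left (Submodule.mem_span_singleton_self q))
  obtain ⟨N, hN⟩ := exists_nat_gt ((d : ℝ) / ε)
  rw [div_lt_iff₀ hε] at hN
  have hN0 : 0 < N := by
    rcases Nat.eq_zero_or_pos N with rfl | h
    · have := Nat.cast_nonneg (α := ℝ) d
      simp only [Nat.cast_zero, zero_mul] at hN
      linarith
    · exact h
  have h1 : ∀ v ∈ boundedDegree (1 : Polynomial K) N, ∃ p ∈ Polynomial.degreeLT K N,
      v = algebraMap (Polynomial K) (RatFunc K) p := by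
    rintro _ ⟨p, hp, rfl⟩
    exact ⟨p, hp, by simp⟩
  have hne : (boundedDegree (1 : Polynomial K) N).baseChange R ≠ ⊥ := by
    intro h0
    have h2 := freeDim_baseChange ρ (boundedDegree (1 : Polynomial K) N)
    rw [finrank_boundedDegree one_ne_zero, h0, ← Submodule.baseChange_bot (R := K),
      freeDim_baseChange ρ, finrank_bot] at h2
    omega
  refine ⟨⟨_, ⟨boundedDegree 1 N, inferInstance, rfl⟩, hne⟩,
    (boundedDegree q (N + d)).baseChange R, ⟨_, inferInstance, rfl⟩, ?_, ?_, ?_⟩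
  · refine Submodule.baseChange_mono R fun v hv => ?_
    obtain ⟨p, hp, rfl⟩ := h1 v hv
    exact mem_boundedDegree hq0 (mul_mem_degreeLT hp hqd) (map_mul _ _ _).symm
  · intro w hw s hs
    refine mul_mem_baseChange (fun v hv u hu => ?_) hw (hPU s hs)
    obtain ⟨p, hp, rfl⟩ := h1 v hv
    obtain ⟨p', hp'⟩ := hq u hu
    have hp'd : p' ∈ Polynomial.degreeLT K d := by
      refine hd (Submodule.mem_sup_right ⟨u, hu, ?_⟩)
      simp [hp', polyPart_algebraMap]
    refine mem_boundedDegree hq0 (mul_mem_degreeLT hp hp'd) ?_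
    rw [map_mul, ← hp']
    ring
  · rw [freeDim_baseChange ρ, freeDim_baseChange ρ, finrank_boundedDegree hq0,
      finrank_boundedDegree one_ne_zero]
    push_cast
    linarith

lemma IsInvariant.mono {S : Type*} [Ring S] [Module R S] {F : Set (Submodule R S)}
    {P P' : Finset S} {ε ε' : ℝ} (hP : P ⊆ P') (hε : ε' ≤ ε) {W : Hat F}
    (h : IsInvariant F P' ε' W) : IsInvariant F P ε W := by
  obtain ⟨W', hW', h1, h2, h3⟩ := h
  refine ⟨W', hW', h1, fun w hw v hv => h2 w hw v (hP hv), h3.trans ?_⟩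
  exact mul_le_mul_of_nonneg_right (by linarith) (Nat.cast_nonneg _)

theorem exists_isNonprincipal (K : Type*) [Field K] [Algebra K R] (ρ : SylvesterRank R) :
    ∃ ω : Ultrafilter (Hat (fieldSystem K (RatFunc K) R)), IsNonprincipal ω := by
  classical
  let I := Finset (R ⊗[K] RatFunc K) × {ε : ℝ // 0 < ε}
  let f : I → Filter (Hat (fieldSystem K (RatFunc K) R)) := fun i =>
    𝓟 {W | IsInvariant (fieldSystem K (RatFunc K) R) i.1 i.2 W}
  have : Nonempty I := ⟨(∅, ⟨1, one_pos⟩)⟩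
  have hdir : Directed (· ≥ ·) f := fun i j =>
    ⟨(i.1 ∪ j.1, ⟨min i.2 j.2, lt_min i.2.2 j.2.2⟩),
      principal_mono.2 fun _ hW =>
        IsInvariant.mono Finset.subset_union_left (min_le_left _ _) hW,
      principal_mono.2 fun _ hW =>
        IsInvariant.mono Finset.subset_union_right (min_le_right _ _) hW⟩
  have hne : (iInf f).NeBot := by
    refine iInf_neBot_of_directed' hdir fun i => principal_neBot_iff.2 ?_
    exact exists_isInvariant ρ i.1 i.2.2
  refine ⟨Ultrafilter.of (iInf f), fun P ε hε => ?_⟩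
  exact (Ultrafilter.of_le (iInf f)).trans (iInf_le f (P, ⟨ε, hε⟩)) (mem_principal_self _)

end Existence

end AmenableExtension

theorem proposition9p6 {K : Type*} [Field K] {R : Type*} [Ring R] [Algebra K R]
    (ρ : SylvesterRank R) (x : ℕ → K) (hx : Function.Injective x) :
    (∃ ω : Ultrafilter (AmenableExtension.Hat (AmenableExtension.fieldSystem K (RatFunc K) R)),
      AmenableExtension.IsNonprincipal ω) ∧
    ∀ ω : Ultrafilter (AmenableExtension.Hat (AmenableExtension.fieldSystem K (RatFunc K) R)),
      AmenableExtension.IsNonprincipal ω →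
      ∀ (n m : ℕ) (A : Matrix (Fin n) (Fin m) (Polynomial R)),
        Tendsto
          (AmenableExtension.normalizedRank ρ (AmenableExtension.fieldSystem K (RatFunc K) R)
            (A.map (AmenableExtension.polynomialInclusion K R)))
          ω
          (𝓝 (AmenableExtension.extendedRank ρ
            (AmenableExtension.fieldSystem K (RatFunc K) R) ω
            (A.map (AmenableExtension.polynomialInclusion K R)))) ∧
        Tendsto (fun i : ℕ => ρ.rk (A.map (AmenableExtension.evalAt K R (x i)))) atTop
          (𝓝 (AmenableExtension.extendedRank ρ
            (AmenableExtension.fieldSystem K (RatFunc K) R) ω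
            (A.map (AmenableExtension.polynomialInclusion K R)))) := by
  refine ⟨AmenableExtension.exists_isNonprincipal K ρ, fun ω hω n m A => ?_⟩
  obtain ⟨L, hL, hL'⟩ := AmenableExtension.exists_tendsto_normalizedRank_and_rk ρ hx hω A
  rw [AmenableExtension.extendedRank, hL.limUnder_eq]
  exact ⟨hL, hL'⟩
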